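/- Let $n,k\ge 0$ be integers. Given right endpoints $r_1,\dots,r_n\ge 0$, consider the horizontal segments ("semi-bars") $[0,r_i]\times\{-i\}$ in the plane, $i=1,\dots,n$. The semi-bar $k$-visibility graph of this representation has vertex set $\{1,\dots,n\}$, and $i\ne j$ are adjacent if and only if some vertical line segment joins a point of the $i$-th semi-bar to a point of the $j$-th semi-bar and intersects at most $k$ of the other semi-bars. The random semi-bar $k$-visibility graph on $n$ vertices is the graph obtained when $r_1,\dots,r_n$ are i.i.d. uniform on $(0,1)$; write $\mathcal G_n^k$ for its distribution. Theorem. (0) $\mathcal G_n^k$ is also the distribution of the semi-bar $k$-visibility graph with $r_i=\sigma(i)$, where $\sigma$ is a uniformly random permutation of $\{1,\dots,n\}$. Let $G\sim\mathcal G_n^k$ and let $E$ be the number of edges of $G$. (1) If $n\le k+2$, then $\mathbb E[E]=\binom n2$. (2) If $n\ge k+3$, then $$\mathbb E[E]=\frac12(k+1)\left(4n-3k-6-2(k+2)\sum_{l=k+3}^{n}\frac1l\right);$$ in particular, for each fixed $k$, $\mathbb E[E]=(k+1)(2n-o(n))$ as $n\to\infty$. (3) For every $n$ and every real $t\ge 0$,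 $$\mathbb P\bigl(|E-\mathbb E[E]|>(k+1)t\bigr)\le 2\exp\left(-\frac{2t^2}{n}\right)$$ (for $n=0$, where the probability is $0$, the right-hand side is read as $2$). -/

import Mathlib

open MeasureTheory

namespace SemiBar

/-- The `k`-visibility graph (with vertical lines of sight) of a family of regions in the plane:
two distinct regions are adjacent when some vertical segment joins a point of one to a point of the
other and meets at most `k` of the other regions. -/
def visibilityGraph {ι : Type*} [Finite ι] (k : ℕ) (R : ι → Set (ℝ × ℝ)) : SimpleGraph ι where
  Adj i j := i ≠ j ∧ ∃ p ∈ R i, ∃ q ∈ R j, p.1 = q.1 ∧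
    {l : ι | l ≠ i ∧ l ≠ j ∧ (R l ∩ segment ℝ p q).Nonempty}.ncard ≤ k
  symm := ⟨by
    rintro i j ⟨hij, p, hp, q, hq, hpq, hk⟩
    refine ⟨hij.symm, q, hq, p, hp, hpq.symm, ?_⟩
    rw [segment_symm]
    simpa only [and_left_comm] using hk⟩
  loopless := ⟨fun _ h => h.1 rfl⟩

/-- The semi-bars with right endpoints `r 0, r 1, …`, listed from top to bottom: the `i`-th one is
the closed horizontal segment from `(0, -i)` to `(r i, -i)`. -/
def bars {n : ℕ} (r : Fin n → ℝ) (i : Fin n) : Set (ℝ × ℝ) :=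
  {p | 0 ≤ p.1 ∧ p.1 ≤ r i ∧ p.2 = -(i : ℝ)}

/-- The semi-bar `k`-visibility graph of the representation with right endpoints `r`. -/
def graph {n : ℕ} (k : ℕ) (r : Fin n → ℝ) : SimpleGraph (Fin n) :=
  visibilityGraph k (bars r)

/-- Finite graphs carry the discrete σ-algebra. -/
instance instMeasurableSpaceGraph {n : ℕ} : MeasurableSpace (SimpleGraph (Fin n)) := ⊤

/-- The law of `n` independent uniform random variables on `(0, 1)`. -/
noncomputable def uniformEndpoints (n : ℕ) : Measure (Fin n → ℝ) :=
  Measure.pi fun _ => (volume : Measure ℝ).restrict (Set.Ioo 0 1)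

/-- The distribution of the random semi-bar `k`-visibility graph on `n` vertices: the right
endpoints of the semi-bars are i.i.d. uniform on `(0, 1)`. -/
noncomputable def graphLaw (n k : ℕ) : Measure (SimpleGraph (Fin n)) :=
  (uniformEndpoints n).map (graph k)

/-- The distribution of the semi-bar `k`-visibility graph of a uniformly random permutation `σ`:
the `i`-th bar from the top has length `σ i + 1`, where `σ i` is between `0` and `n - 1`. -/
noncomputable def permGraphLaw (n k : ℕ) : Measure (SimpleGraph (Fin n)) :=
  ((PMF.uniformOfFintype (Equiv.Perm (Fin n))).map
    fun σ => graph k fun i => ((σ i : ℕ) : ℝ) + 1).toMeasure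

/-- The number of edges of a graph, as a real number. -/
noncomputable def edgeCount {n : ℕ} (G : SimpleGraph (Fin n)) : ℝ := (G.edgeSet.ncard : ℝ)

/-- The expected number of edges of the random semi-bar `k`-visibility graph on `n` vertices. -/
noncomputable def expectedEdges (n k : ℕ) : ℝ := ∫ G, edgeCount G ∂(graphLaw n k)

/-! Well-definedness of the law: the graph is a measurable function of the endpoints. -/

theorem graph_adj_iff {n k : ℕ} (r : Fin n → ℝ) (i j : Fin n) :
    (graph k r).Adj i j ↔ i ≠ j ∧ 0 ≤ r i ∧ 0 ≤ r j ∧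
      {l : Fin n | min i j < l ∧ l < max i j ∧ min (r i) (r j) ≤ r l}.ncard ≤ k := by
  have key : ∀ x : ℝ, 0 ≤ x → ∀ l : Fin n,
      (l ≠ i ∧ l ≠ j ∧ (bars r l ∩ segment ℝ (x, -(i : ℝ)) (x, -(j : ℝ))).Nonempty) ↔
      (min i j < l ∧ l < max i j ∧ x ≤ r l) := by
    intro x hx l
    rw [← Prod.image_mk_segment_right, segment_eq_uIcc]
    have hset : (bars r l ∩ (fun y => (x, y)) '' Set.uIcc (-(i : ℝ)) (-(j : ℝ))).Nonempty ↔
        x ≤ r l ∧ -(l : ℝ) ∈ Set.uIcc (-(i : ℝ)) (-(j : ℝ)) := by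
      constructor
      · rintro ⟨_, hp, y, hy, rfl⟩
        obtain ⟨_, h2, h3⟩ := hp
        simp only at h2 h3
        exact ⟨h2, h3 ▸ hy⟩
      · rintro ⟨h1, h2⟩
        exact ⟨(x, -(l : ℝ)), ⟨hx, h1, rfl⟩, _, h2, rfl⟩
    rw [hset, Set.mem_uIcc]
    simp only [neg_le_neg_iff, Nat.cast_le, Fin.val_fin_le]
    rcases le_total i j with h | h
    · simp only [min_eq_left h, max_eq_right h]
      constructor
      · rintro ⟨h1, h2, h3, h4⟩
        grind
      · grind
    · simp only [min_eq_right h, max_eq_left h]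
      constructor
      · rintro ⟨h1, h2, h3, h4⟩
        grind
      · grind
  constructor
  · rintro ⟨hij, ⟨x, y⟩, ⟨hx, hxi, hy⟩, ⟨x', y'⟩, ⟨_, hxj, hy'⟩, hxx, hk⟩
    simp only at hx hxi hy hxj hy' hxx
    subst hxx hy hy'
    refine ⟨hij, hx.trans hxi, hx.trans hxj, le_trans (Set.ncard_le_ncard ?_ (Set.toFinite _)) hk⟩
    rintro l ⟨h1, h2, h3⟩
    exact (key x hx l).2 ⟨h1, h2, (le_min hxi hxj).trans h3⟩
  · rintro ⟨hij, hi, hj, hk⟩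
    refine ⟨hij, (min (r i) (r j), -(i : ℝ)), ⟨le_min hi hj, min_le_left _ _, rfl⟩,
      (min (r i) (r j), -(j : ℝ)), ⟨le_min hi hj, min_le_right _ _, rfl⟩, rfl, ?_⟩
    simpa only [key _ (le_min hi hj)] using hk

theorem measurable_graph (n k : ℕ) : Measurable (graph k : (Fin n → ℝ) → SimpleGraph (Fin n)) := by
  have hadj : ∀ i j : Fin n, Measurable fun r : Fin n → ℝ => (graph k r).Adj i j := by
    intro i j
    have hle : ∀ l : Fin n, Measurable fun r : Fin n → ℝ => min (r i) (r j) ≤ r l := fun l =>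
      measurableSet_setOfPred.1 (measurableSet_le
        ((measurable_pi_apply i).min (measurable_pi_apply j)) (measurable_pi_apply l))
    have hpos : ∀ l : Fin n, Measurable fun r : Fin n → ℝ => 0 ≤ r l := fun l =>
      measurableSet_setOfPred.1 (measurableSet_le measurable_const (measurable_pi_apply l))
    have hm : Measurable fun r : Fin n → ℝ =>
        {l : Fin n | min i j < l ∧ l < max i j ∧ min (r i) (r j) ≤ r l} :=
      measurable_set_iff.2 fun l => measurable_const.and (measurable_const.and (hle l))
    have hcard : Measurable fun s : Set (Fin n) => s.ncard ≤ k := measurable_of_finite _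
    simp only [graph_adj_iff]
    exact measurable_const.and ((hpos i).and ((hpos j).and (hcard.comp hm)))
  refine measurable_to_countable' fun G => ?_
  have : (graph k ⁻¹' {G} : Set (Fin n → ℝ)) =
      ⋂ i, ⋂ j, {r | (graph k r).Adj i j ↔ G.Adj i j} := by
    ext r
    simp [SimpleGraph.ext_iff, funext_iff]
  rw [this]
  exact MeasurableSet.iInter fun i => MeasurableSet.iInter fun j =>
    ((hadj i j).iff measurable_const).setOf

instance instProbUniformEndpoints (n : ℕ) : IsProbabilityMeasure (uniformEndpoints n) := by
  have : IsProbabilityMeasure ((volume : Measure ℝ).restrict (Set.Ioo 0 1)) := ⟨by simp⟩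
  unfold uniformEndpoints
  infer_instance

instance instProbGraphLaw (n k : ℕ) : IsProbabilityMeasure (graphLaw n k) :=
  Measure.isProbabilityMeasure_map (measurable_graph n k).aemeasurable

end SemiBar

/-! Build the representation by adding bars in decreasing order of length. A new shortest bar never
blocks a sight line between older bars, and every bar lying between it and a target blocks its view.
So inserting it at position `p` among `n` older bars adds exactly `nearCount k n p` edges, whatever
the older order (`edgeCount_permGraph_insertMin`). Ties have probability zero and the relative order
of the endpoints is a uniform permutation (`graphLaw_eq_sum_dirac`), so `p` is uniform and
independent of the older bars (`integral_graphLaw_succ`). Hence the edge count is a sum of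
independent increments. Adding their means gives the expectation; each increment lies in an interval
of length `k + 1`, so Hoeffding's lemma and a Chernoff bound give the concentration. -/

namespace SemiBar

/-! ### Deleting a shortest bar -/

/-- The graph depends only on the relative order of the (non-negative) right endpoints. -/
theorem graph_eq_of_le_iff_le {n : ℕ} (k : ℕ) {r s : Fin n → ℝ} (hr : ∀ i, 0 ≤ r i)
    (hs : ∀ i, 0 ≤ s i) (h : ∀ i j, r i ≤ r j ↔ s i ≤ s j) : graph k r = graph k s := by
  ext i j
  simp only [graph_adj_iff, hr, hs, true_and, min_le_iff, h]

/-- Removing a strictly shortest bar does not change the visibility between the other bars. -/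
theorem comap_succAbove_graph {n : ℕ} (k : ℕ) {r : Fin (n + 1) → ℝ} {p : Fin (n + 1)}
    (hp : ∀ i, r p < r (p.succAbove i)) :
    (graph k r).comap p.succAbove = graph k (r ∘ p.succAbove) := by
  ext i j
  rw [SimpleGraph.comap_adj, graph_adj_iff, graph_adj_iff, p.succAbove_right_injective.ne_iff]
  -- The bar `p` is too short to be a blocker, so all blockers lie in the range of `p.succAbove`.
  have hset : {l | min (p.succAbove i) (p.succAbove j) < l ∧ l < max (p.succAbove i) (p.succAbove j)
      ∧ min (r (p.succAbove i)) (r (p.succAbove j)) ≤ r l} = p.succAbove ''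
        {l | min i j < l ∧ l < max i j ∧
          min ((r ∘ p.succAbove) i) ((r ∘ p.succAbove) j) ≤ (r ∘ p.succAbove) l} := by
    ext l
    rcases Fin.eq_self_or_eq_succAbove p l with rfl | ⟨l, rfl⟩
    · have : ∀ i, l.succAbove i ≠ l := Fin.succAbove_ne l
      simp [this, (hp i).not_ge, (hp j).not_ge]
    · simp [p.succAbove_right_injective.eq_iff]
  rw [hset, Set.ncard_image_of_injective _ p.succAbove_right_injective]
  rfl

/-- A strictly shortest bar sees exactly the bars that are at most `k + 1` positions away. -/
theorem graph_adj_shortest_iff {n : ℕ} (k : ℕ) {r : Fin n → ℝ} {p : Fin n}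
    (h0 : ∀ i, 0 ≤ r i) (hp : ∀ i, r p ≤ r i) (j : Fin n) :
    (graph k r).Adj p j ↔ p ≠ j ∧ (j : ℕ) ≤ p + (k + 1) ∧ (p : ℕ) ≤ j + (k + 1) := by
  have hset : {l : Fin n | min p j < l ∧ l < max p j ∧ min (r p) (r j) ≤ r l} =
      (Finset.Ioo (min p j) (max p j) : Set (Fin n)) := by
    ext l
    simp [hp]
  rw [graph_adj_iff, hset, Set.ncard_coe_finset, Fin.card_Ioo]
  simp only [h0, true_and]
  refine and_congr_right fun hne => ?_
  have hne' : (p : ℕ) ≠ j := Fin.val_ne_of_ne hne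
  rcases le_total p j with h | h <;> simp only [h, max_eq_left, max_eq_right, min_eq_left,
    min_eq_right] <;> rw [Fin.le_def] at h <;> omega

theorem two_mul_edgeCount {n : ℕ} (G : SimpleGraph (Fin n)) [DecidableRel G.Adj] :
    2 * edgeCount G = ∑ i, ∑ j, if G.Adj i j then (1 : ℝ) else 0 := by
  have h := G.sum_degrees_eq_twice_card_edges
  rw [edgeCount, ← G.coe_edgeFinset, Set.ncard_coe_finset]
  have h' := congrArg (Nat.cast : ℕ → ℝ) h
  push_cast at h'
  rw [← h']
  refine Finset.sum_congr rfl fun i _ => ?_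
  rw [SimpleGraph.degree, G.neighborFinset_eq_filter, Finset.sum_boole]

/-- Deleting a vertex removes as many edges as it has neighbours. -/
theorem edgeCount_eq_comap_add {n : ℕ} (G : SimpleGraph (Fin (n + 1))) [DecidableRel G.Adj]
    (p : Fin (n + 1)) :
    edgeCount G = edgeCount (G.comap p.succAbove) + ∑ j, if G.Adj p j then (1 : ℝ) else 0 := by
  have h := two_mul_edgeCount G
  have h' := two_mul_edgeCount (G.comap p.succAbove)
  rw [Fin.sum_univ_succAbove _ p, Finset.sum_congr rfl fun i _ => Fin.sum_univ_succAbove _ p,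
    Finset.sum_add_distrib] at h
  simp only [SimpleGraph.comap_adj] at h'
  rw [← h'] at h
  have h2 : ∑ j, (if G.Adj p j then (1 : ℝ) else 0) =
      ∑ i, if G.Adj (p.succAbove i) p then (1 : ℝ) else 0 := by
    rw [Fin.sum_univ_succAbove _ p]
    simp [G.adj_comm p]
  linarith

/-- The number of the bars `0, …, n` other than the `p`-th one that are at most `k + 1` positions
away from it. -/
def nearCount (k n : ℕ) (p : ℕ) : ℕ := min p (k + 1) + min (n - p) (k + 1)

theorem sum_near_eq_nearCount (k n : ℕ) (p : Fin (n + 1)) :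
    (∑ j : Fin (n + 1), if p ≠ j ∧ (j : ℕ) ≤ p + (k + 1) ∧ (p : ℕ) ≤ j + (k + 1)
      then (1 : ℝ) else 0) = nearCount k n p := by
  rw [Finset.sum_boole, ← Finset.card_map Fin.valEmbedding]
  have hset : (Finset.univ.filter fun j : Fin (n + 1) =>
      p ≠ j ∧ (j : ℕ) ≤ p + (k + 1) ∧ (p : ℕ) ≤ j + (k + 1)).map Fin.valEmbedding =
      Finset.Ico ((p : ℕ) - (k + 1)) p ∪ Finset.Ioc (p : ℕ) (min n (p + (k + 1))) := by
    ext m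
    simp only [Finset.mem_map, Finset.mem_filter, Finset.mem_univ, true_and, Fin.valEmbedding_apply,
      Finset.mem_union, Finset.mem_Ico, Finset.mem_Ioc, Fin.ext_iff, ne_eq]
    constructor
    · rintro ⟨j, hj, rfl⟩
      omega
    · intro h
      exact ⟨⟨m, by omega⟩, by simp only; omega, rfl⟩
  have hdisj : Disjoint (Finset.Ico ((p : ℕ) - (k + 1)) p)
      (Finset.Ioc (p : ℕ) (min n (p + (k + 1)))) := by
    rw [Finset.disjoint_left]
    intro m
    simp only [Finset.mem_Ico, Finset.mem_Ioc]
    omega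
  rw [hset, Finset.card_union_of_disjoint hdisj, Nat.card_Ico, Nat.card_Ioc, nearCount]
  congr 1
  omega

/-! ### Permutations and insertion of a minimum -/

/-- The semi-bar graph of a permutation. -/
noncomputable def permGraph {n : ℕ} (k : ℕ) (σ : Equiv.Perm (Fin n)) : SimpleGraph (Fin n) :=
  graph k fun i => ((σ i : ℕ) : ℝ) + 1

/-- The permutation that has its minimum at `p` and the relative order of `τ` elsewhere. -/
def insertMin {n : ℕ} (x : Fin (n + 1) × Equiv.Perm (Fin n)) : Equiv.Perm (Fin (n + 1)) :=
  ((finSuccEquiv' x.1).trans (Equiv.optionCongr x.2)).trans (finSuccEquiv' 0).symm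

@[simp] theorem insertMin_self {n : ℕ} (p : Fin (n + 1)) (τ : Equiv.Perm (Fin n)) :
    insertMin (p, τ) p = 0 := by
  simp [insertMin]

@[simp] theorem insertMin_succAbove {n : ℕ} (p : Fin (n + 1)) (τ : Equiv.Perm (Fin n))
    (i : Fin n) : insertMin (p, τ) (p.succAbove i) = (τ i).succ := by
  simp [insertMin]

/-- The position of the value `0` recovers `p`, the remaining values recover `τ`, and `(n + 1) * n!
= (n + 1)!`. -/
theorem insertMin_bijective (n : ℕ) :
    Function.Bijective (insertMin : Fin (n + 1) × Equiv.Perm (Fin n) → _) := by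
  rw [Fintype.bijective_iff_injective_and_card]
  refine ⟨?_, by simp [Fintype.card_perm, Nat.factorial_succ]⟩
  rintro ⟨p, τ⟩ ⟨q, ρ⟩ h
  have hpq : p = q := by
    apply (insertMin (q, ρ)).injective
    rw [insertMin_self, ← h, insertMin_self]
  subst hpq
  congr 1
  refine Equiv.ext fun i => ?_
  have := congrArg (fun σ : Equiv.Perm (Fin (n + 1)) => σ (p.succAbove i)) h
  simpa using this

theorem edgeCount_permGraph_insertMin {n : ℕ} (k : ℕ) (p : Fin (n + 1)) (τ : Equiv.Perm (Fin n)) :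
    edgeCount (permGraph k (insertMin (p, τ))) =
      edgeCount (permGraph k τ) + nearCount k n p := by
  classical
  rw [edgeCount_eq_comap_add _ p, permGraph, comap_succAbove_graph k (by simp; intro i; positivity),
    ← sum_near_eq_nearCount]
  congr 1
  · rw [permGraph]
    congr 1
    refine graph_eq_of_le_iff_le k (fun i => by simp only [Function.comp]; positivity)
      (fun i => by positivity) fun i j => ?_
    simp
  · refine Finset.sum_congr rfl fun j _ => ?_
    have h := graph_adj_shortest_iff k (p := p) (j := j)
      (r := fun i => ((insertMin (p, τ) i : ℕ) : ℝ) + 1) (fun i => by positivity) (fun i => by simp)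
    simp only [h]

/-! ### The relative order of the endpoints is uniform -/

/-- The endpoint families whose relative order is that of the permutation `σ`. -/
def orderCone {n : ℕ} (σ : Equiv.Perm (Fin n)) : Set (Fin n → ℝ) :=
  {r | (∀ i, 0 ≤ r i) ∧ ∀ i j, r i ≤ r j ↔ σ i ≤ σ j}

theorem measurableSet_orderCone {n : ℕ} (σ : Equiv.Perm (Fin n)) :
    MeasurableSet (orderCone σ) := by
  have h1 : ∀ i j : Fin n, MeasurableSet {r : Fin n → ℝ | r i ≤ r j} := fun i j =>
    measurableSet_le (measurable_pi_apply i) (measurable_pi_apply j)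
  have h2 : ∀ i : Fin n, MeasurableSet {r : Fin n → ℝ | 0 ≤ r i} := fun i =>
    measurableSet_le measurable_const (measurable_pi_apply i)
  have : orderCone σ = (⋂ i, {r | 0 ≤ r i}) ∩ ⋂ i, ⋂ j, {r | r i ≤ r j ↔ σ i ≤ σ j} := by
    ext r
    simp [orderCone]
  rw [this]
  refine (MeasurableSet.iInter h2).inter <| MeasurableSet.iInter fun i =>
    MeasurableSet.iInter fun j => ?_
  by_cases h : σ i ≤ σ j
  · simpa [h] using h1 i j
  · simp only [h, iff_false]
    exact (h1 i j).compl

theorem pairwise_disjoint_orderCone (n : ℕ) :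
    Pairwise fun σ τ : Equiv.Perm (Fin n) => Disjoint (orderCone σ) (orderCone τ) := by
  intro σ τ hne
  rw [Set.disjoint_left]
  rintro r ⟨_, h1⟩ ⟨_, h2⟩
  apply hne
  -- The only strictly increasing self-map of `Fin n` is the identity.
  have hmono : StrictMono (τ ∘ σ.symm) := by
    refine Monotone.strictMono_of_injective (fun i j hij => ?_) (τ.injective.comp σ.symm.injective)
    simp only [Function.comp, ← h2, h1, Equiv.apply_symm_apply, hij]
  have hid : τ ∘ σ.symm = id := hmono.eq_id
  ext i
  have := congrFun hid (σ i)
  simp at this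
  rw [this]

/-- Permuting the coordinates preserves the law of the endpoints. -/
theorem measurePreserving_comp_perm {n : ℕ} (σ : Equiv.Perm (Fin n)) :
    MeasurePreserving (fun r : Fin n → ℝ => r ∘ σ) (uniformEndpoints n) (uniformEndpoints n) := by
  have : IsProbabilityMeasure ((volume : Measure ℝ).restrict (Set.Ioo 0 1)) := ⟨by simp⟩
  have h := measurePreserving_piCongrLeft (α := fun _ : Fin n => ℝ)
    (fun _ => (volume : Measure ℝ).restrict (Set.Ioo 0 1)) σ.symm
  have hfun : (fun r : Fin n → ℝ => r ∘ σ) =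
      MeasurableEquiv.piCongrLeft (fun _ : Fin n => ℝ) σ.symm := ?_
  · rw [hfun]
    exact h
  ext r i
  obtain ⟨j, rfl⟩ := σ.symm.surjective i
  simp [MeasurableEquiv.piCongrLeft, Equiv.piCongrLeft_apply_apply]

theorem uniformEndpoints_orderCone {n : ℕ} (σ τ : Equiv.Perm (Fin n)) :
    uniformEndpoints n (orderCone σ) = uniformEndpoints n (orderCone τ) := by
  -- Precomposition with `τ⁻¹ * σ` pulls the cone of `σ` back to that of `τ`.
  rw [← (measurePreserving_comp_perm (τ⁻¹ * σ)).measure_preimage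
    (measurableSet_orderCone σ).nullMeasurableSet]
  congr 1
  ext r
  simp only [orderCone, Set.mem_preimage, Set.mem_ofPred_eq, Function.comp]
  constructor
  · rintro ⟨h0, h⟩
    refine ⟨fun i => ?_, fun i j => ?_⟩
    · simpa using h0 (σ⁻¹ (τ i))
    · simpa using h (σ⁻¹ (τ i)) (σ⁻¹ (τ j))
  · rintro ⟨h0, h⟩
    exact ⟨fun i => h0 _, fun i j => by simp [h]⟩

theorem ae_uniformEndpoints_mem_Ioo (n : ℕ) :
    ∀ᵐ r ∂uniformEndpoints n, ∀ i, r i ∈ Set.Ioo (0 : ℝ) 1 := by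
  have : IsProbabilityMeasure ((volume : Measure ℝ).restrict (Set.Ioo 0 1)) := ⟨by simp⟩
  rw [ae_all_iff]
  intro i
  have h := measurePreserving_eval (fun _ : Fin n => (volume : Measure ℝ).restrict (Set.Ioo 0 1)) i
  exact h.quasiMeasurePreserving.ae (ae_restrict_mem measurableSet_Ioo)

/-- Each tie `r i = r j` defines a proper subspace, which is Lebesgue-null. -/
theorem ae_uniformEndpoints_injective (n : ℕ) :
    ∀ᵐ r ∂uniformEndpoints n, Function.Injective r := by
  have hne : ∀ i j : Fin n, i ≠ j → ∀ᵐ r ∂uniformEndpoints n, r i ≠ r j := by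
    intro i j hij
    have habs : uniformEndpoints n ≪ volume := by
      rw [uniformEndpoints, ← Measure.restrict_pi_pi]
      exact Measure.absolutelyContinuous_restrict
    suffices h : ∀ᵐ r ∂(volume : Measure (Fin n → ℝ)), r i ≠ r j from habs.ae_le h
    let S : Submodule ℝ (Fin n → ℝ) :=
      LinearMap.ker (LinearMap.proj i - LinearMap.proj (R := ℝ) (φ := fun _ : Fin n => ℝ) j)
    have hS : S ≠ ⊤ := by
      intro h
      have : (Pi.single i 1 : Fin n → ℝ) ∈ S := h ▸ Submodule.mem_top
      simp [S, hij.symm] at this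
    have h0 := Measure.addHaar_submodule (volume : Measure (Fin n → ℝ)) S hS
    rw [ae_iff]
    convert h0 using 2
    ext r
    simp [S, sub_eq_zero]
  filter_upwards [ae_all_iff.2 fun i => ae_all_iff.2 fun j => ae_all_iff.2 (hne i j)] with r hr
  intro i j h
  by_contra hij
  exact hr i j hij h

theorem ae_exists_mem_orderCone (n : ℕ) :
    ∀ᵐ r ∂uniformEndpoints n, r ∈ ⋃ σ : Equiv.Perm (Fin n), orderCone σ := by
  filter_upwards [ae_uniformEndpoints_mem_Ioo n, ae_uniformEndpoints_injective n] with r h0 hinj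
  rw [Set.mem_iUnion]
  -- `Tuple.sort r` sends ranks to indices; its inverse gives the rank of each endpoint.
  refine ⟨(Tuple.sort r)⁻¹, fun i => (h0 i).1.le, fun i j => ?_⟩
  have hmono : StrictMono (r ∘ Tuple.sort r) :=
    (Tuple.monotone_sort r).strictMono_of_injective (hinj.comp (Tuple.sort r).injective)
  rw [← hmono.le_iff_le]
  simp

theorem uniformEndpoints_orderCone_eq {n : ℕ} (σ : Equiv.Perm (Fin n)) :
    uniformEndpoints n (orderCone σ) = ((n.factorial : ℕ) : ENNReal)⁻¹ := by
  have h1 : uniformEndpoints n (⋃ τ : Equiv.Perm (Fin n), orderCone τ) = 1 :=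
    (prob_compl_eq_zero_iff <|
      MeasurableSet.iUnion measurableSet_orderCone).1 (ae_exists_mem_orderCone n)
  rw [measure_iUnion (pairwise_disjoint_orderCone n) measurableSet_orderCone, tsum_fintype,
    Finset.sum_congr rfl fun τ _ => uniformEndpoints_orderCone τ σ, Finset.sum_const,
    Finset.card_univ, Fintype.card_perm, Fintype.card_fin, nsmul_eq_mul, mul_comm] at h1
  exact ENNReal.eq_inv_of_mul_eq_one_left h1

instance instDiscreteMeasurableSpaceGraph {n : ℕ} :
    DiscreteMeasurableSpace (SimpleGraph (Fin n)) := ⟨fun _ => trivial⟩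

theorem graphLaw_eq_sum_dirac (n k : ℕ) :
    graphLaw n k = ∑ σ : Equiv.Perm (Fin n),
      ((n.factorial : ℕ) : ENNReal)⁻¹ • Measure.dirac (permGraph k σ) := by
  classical
  ext s hs
  rw [graphLaw, Measure.map_apply (measurable_graph n k) hs,
    ← measure_inter_conull (t := ⋃ σ : Equiv.Perm (Fin n), orderCone σ)
      (ae_exists_mem_orderCone n),
    Set.inter_iUnion, measure_iUnion
      (fun σ τ h => ((pairwise_disjoint_orderCone n) h).mono Set.inter_subset_right
        Set.inter_subset_right)
      (fun σ => (measurable_graph n k hs).inter (measurableSet_orderCone σ)),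
    tsum_fintype, Measure.finsetSum_apply]
  refine Finset.sum_congr rfl fun σ _ => ?_
  have hgraph : ∀ r ∈ orderCone σ, graph k r = permGraph k σ := fun r hr =>
    graph_eq_of_le_iff_le k hr.1 (fun i => by positivity) fun i j => by simp [hr.2]
  rw [Measure.smul_apply, Measure.dirac_apply' _ hs, smul_eq_mul]
  by_cases h : permGraph k σ ∈ s
  · rw [Set.indicator_of_mem h, Pi.one_apply, mul_one, ← uniformEndpoints_orderCone_eq σ]
    congr 1
    ext r
    simp only [Set.mem_inter_iff, Set.mem_preimage, and_iff_right_iff_imp]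
    intro hr
    rwa [hgraph r hr]
  · rw [Set.indicator_of_notMem h, mul_zero]
    convert measure_empty (μ := uniformEndpoints n)
    ext r
    simp only [Set.mem_inter_iff, Set.mem_preimage, Set.mem_empty_iff_false, iff_false, not_and']
    intro hr
    rwa [hgraph r hr]

theorem permGraphLaw_eq_sum_dirac (n k : ℕ) :
    permGraphLaw n k = ∑ σ : Equiv.Perm (Fin n),
      ((n.factorial : ℕ) : ENNReal)⁻¹ • Measure.dirac (permGraph k σ) := by
  classical
  refine Measure.ext_of_singleton fun G => ?_
  rw [permGraphLaw, PMF.toMeasure_apply_singleton _ _ (MeasurableSet.of_discrete), PMF.map_apply,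
    tsum_fintype, Measure.finsetSum_apply]
  refine Finset.sum_congr rfl fun σ _ => ?_
  rw [Measure.smul_apply, Measure.dirac_apply' _ MeasurableSet.of_discrete, smul_eq_mul,
    PMF.uniformOfFintype_apply, Fintype.card_perm, Fintype.card_fin]
  change (if G = permGraph k σ then _ else _) = _
  by_cases h : G = permGraph k σ
  · simp [← h]
  · simp [h, Ne.symm h]

/-! ### Recursion and expected number of edges -/

theorem integral_graphLaw (n k : ℕ) (g : SimpleGraph (Fin n) → ℝ) :
    ∫ G, g G ∂graphLaw n k = (n.factorial : ℝ)⁻¹ * ∑ σ, g (permGraph k σ) := by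
  rw [graphLaw_eq_sum_dirac, integral_finsetSum_measure fun σ _ =>
    (Integrable.of_finite (μ := Measure.dirac (permGraph k σ))).smul_measure
      (by simp [Nat.factorial_ne_zero]), Finset.mul_sum]
  refine Finset.sum_congr rfl fun σ _ => ?_
  rw [integral_smul_measure, integral_dirac]
  simp

/-- The shortest of `n + 1` bars is at a uniformly random position, independent of the relative
order of the other bars. -/
theorem integral_graphLaw_succ (n k : ℕ) (g : ℝ → ℝ) :
    ∫ G, g (edgeCount G) ∂graphLaw (n + 1) k =
      ((n : ℝ) + 1)⁻¹ * ∑ p : Fin (n + 1), ∫ G, g (edgeCount G + nearCount k n p) ∂graphLaw n k := by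
  rw [integral_graphLaw, ← (insertMin_bijective n).sum_comp
    (g := fun σ => g (edgeCount (permGraph k σ))), Fintype.sum_prod_type]
  simp only [edgeCount_permGraph_insertMin]
  rw [Finset.sum_congr rfl fun p _ => integral_graphLaw n k _, ← Finset.mul_sum, Nat.factorial_succ]
  push_cast
  rw [mul_inv, mul_assoc]

theorem expectedEdges_zero (k : ℕ) : expectedEdges 0 k = 0 := by
  rw [expectedEdges, integral_graphLaw]
  have : ∀ G : SimpleGraph (Fin 0), edgeCount G = 0 := fun G => by
    simp [edgeCount, Subsingleton.elim G ⊥]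
  simp [this]

theorem expectedEdges_succ (n k : ℕ) :
    expectedEdges (n + 1) k = expectedEdges n k +
      ((n : ℝ) + 1)⁻¹ * ∑ p : Fin (n + 1), (nearCount k n p : ℝ) := by
  have hn : (n : ℝ) + 1 ≠ 0 := by positivity
  rw [expectedEdges, integral_graphLaw_succ n k fun x => x, Finset.sum_congr rfl fun p _ =>
    integral_add Integrable.of_finite Integrable.of_finite, Finset.sum_add_distrib, mul_add]
  simp [expectedEdges, hn]

/-- The reflection `p ↦ n - p` exchanges the two terms of `nearCount`. -/
theorem sum_nearCount_eq (n k : ℕ) :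
    ∑ p : Fin (n + 1), nearCount k n p = 2 * ∑ p ∈ Finset.range (n + 1), min p (k + 1) := by
  rw [Fin.sum_univ_eq_sum_range (fun p => nearCount k n p)]
  simp only [nearCount]
  rw [Finset.sum_add_distrib, two_mul, ← Finset.sum_range_reflect (fun p => min p (k + 1))]
  simp only [Nat.add_sub_cancel]

theorem sum_range_min_of_le {n k : ℕ} (h : n ≤ k + 1) :
    2 * ∑ p ∈ Finset.range (n + 1), min p (k + 1) = (n + 1) * n := by
  rw [Finset.sum_congr rfl fun p hp => min_eq_left (by simp at hp; omega), mul_comm,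
    Finset.sum_range_id_mul_two]
  simp

theorem sum_range_min_of_ge {n k : ℕ} (h : k + 1 ≤ n) :
    2 * ∑ p ∈ Finset.range (n + 1), min p (k + 1) + (k + 1) * k = 2 * (k + 1) * n := by
  induction n, h using Nat.le_induction with
  | base => rw [sum_range_min_of_le le_rfl]; ring
  | succ n hn ih =>
    rw [Finset.sum_range_succ, min_eq_right (by omega)]
    linarith

theorem expectedEdges_of_le {n k : ℕ} (h : n ≤ k + 2) : expectedEdges n k = n.choose 2 := by
  induction n with
  | zero => simp [expectedEdges_zero]
  | succ n ih =>
    have hn : (n : ℝ) + 1 ≠ 0 := by positivity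
    rw [expectedEdges_succ, ih (by omega), ← Nat.cast_sum, sum_nearCount_eq,
      sum_range_min_of_le (by omega), Nat.choose_succ_succ' n 1]
    push_cast [Nat.choose_one_right]
    field_simp
    ring

/-- The mean increment is `(k + 1) * (2 - (k + 2) / (n + 1))`, whence the harmonic sum. Induction
starts at `k + 2`, where that sum is empty and the binomial formula applies. -/
theorem expectedEdges_of_ge {n k : ℕ} (h : k + 2 ≤ n) :
    expectedEdges n k = 1 / 2 * ((k : ℝ) + 1) * (4 * (n : ℝ) - 3 * (k : ℝ) - 6
      - 2 * ((k : ℝ) + 2) * ∑ l ∈ Finset.Icc (k + 3) n, 1 / (l : ℝ)) := by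
  induction n, h using Nat.le_induction with
  | base =>
    rw [expectedEdges_of_le le_rfl, Nat.cast_choose_two]
    simp
    ring
  | succ n hn ih =>
    have hn0 : (n : ℝ) + 1 ≠ 0 := by positivity
    have hs := congrArg (Nat.cast : ℕ → ℝ) (sum_range_min_of_ge (n := n) (k := k) (by omega))
    rw [← sum_nearCount_eq] at hs
    push_cast at hs
    rw [expectedEdges_succ, ih, Finset.sum_Icc_succ_top (by omega), eq_sub_of_add_eq hs]
    push_cast
    field_simp
    ring

theorem sum_Icc_isLittleO (k : ℕ) :
    (fun n : ℕ => ∑ l ∈ Finset.Icc (k + 3) n, 1 / (l : ℝ)) =o[Filter.atTop] fun n : ℕ => (n : ℝ) := by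
  have hlog : (fun n : ℕ => Real.log n) =o[Filter.atTop] fun n : ℕ => (n : ℝ) :=
    Real.isLittleO_log_id_atTop.comp_tendsto tendsto_natCast_atTop_atTop
  have hone : (fun _ : ℕ => (1 : ℝ)) =o[Filter.atTop] fun n : ℕ => (n : ℝ) :=
    (Asymptotics.isLittleO_const_id_atTop (1 : ℝ)).comp_tendsto tendsto_natCast_atTop_atTop
  refine Asymptotics.IsBigO.trans_isLittleO (Asymptotics.IsBigO.of_bound 1 ?_) (hone.add hlog)
  refine Filter.Eventually.of_forall fun n => ?_
  have h0 : 0 ≤ ∑ l ∈ Finset.Icc (k + 3) n, 1 / (l : ℝ) := Finset.sum_nonneg fun l _ => by positivity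
  rw [Real.norm_of_nonneg h0, one_mul]
  refine le_trans ?_ (le_abs_self _)
  refine le_trans ?_ (harmonic_le_one_add_log n)
  rw [harmonic_eq_sum_Icc]
  push_cast
  simp only [one_div]
  exact Finset.sum_le_sum_of_subset_of_nonneg (Finset.Icc_subset_Icc_left (by omega))
    fun l _ _ => by positivity

theorem exists_isLittleO_expectedEdges (k : ℕ) :
    ∃ f : ℕ → ℝ, f =o[Filter.atTop] (fun n : ℕ => (n : ℝ)) ∧
      ∀ n : ℕ, k + 3 ≤ n → expectedEdges n k = ((k : ℝ) + 1) * (2 * (n : ℝ) - f n) := by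
  have hone : (fun _ : ℕ => (3 * (k : ℝ) + 6) / 2) =o[Filter.atTop] fun n : ℕ => (n : ℝ) :=
    (Asymptotics.isLittleO_const_id_atTop _).comp_tendsto tendsto_natCast_atTop_atTop
  refine ⟨_, hone.add ((sum_Icc_isLittleO k).const_mul_left ((k : ℝ) + 2)), fun n hn => ?_⟩
  rw [expectedEdges_of_ge (by omega)]
  ring

/-! ### Concentration -/

/-- The lower bound is subadditivity of `min · (k + 1)`. It halves the trivial width `2 * (k + 1)`,
which yields the constant in the final exponent. -/
theorem nearCount_mem_Icc (k n : ℕ) (p : Fin (n + 1)) :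
    (nearCount k n p : ℝ) ∈
      Set.Icc ((min n (k + 1) : ℕ) : ℝ) ((min n (k + 1) + (k + 1) : ℕ) : ℝ) := by
  have := p.isLt
  rw [Set.mem_Icc, Nat.cast_le, Nat.cast_le, nearCount]
  omega

open ProbabilityTheory in
/-- Hoeffding's lemma for the number of bars seen by a shortest bar. -/
theorem mean_exp_nearCount_le (k n : ℕ) (t : ℝ) :
    ((n : ℝ) + 1)⁻¹ * ∑ p : Fin (n + 1), Real.exp (t * ((nearCount k n p : ℝ) -
      ((n : ℝ) + 1)⁻¹ * ∑ q : Fin (n + 1), (nearCount k n q : ℝ))) ≤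
    Real.exp ((((k : ℝ) + 1) / 2) ^ 2 * t ^ 2 / 2) := by
  have hint : ∀ f : Fin (n + 1) → ℝ, ∫ p, f p ∂(PMF.uniformOfFintype (Fin (n + 1))).toMeasure =
      ((n : ℝ) + 1)⁻¹ * ∑ p, f p := by
    intro f
    rw [PMF.integral_eq_sum, Finset.mul_sum]
    refine Finset.sum_congr rfl fun p _ => ?_
    rw [PMF.uniformOfFintype_apply, Fintype.card_fin, smul_eq_mul, ENNReal.toReal_inv,
      ENNReal.toReal_natCast, Nat.cast_succ]
  have h := (hasSubgaussianMGF_of_mem_Icc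
    (μ := (PMF.uniformOfFintype (Fin (n + 1))).toMeasure)
    (X := fun p => (nearCount k n p : ℝ)) (measurable_of_finite _).aemeasurable
    (Filter.Eventually.of_forall (nearCount_mem_Icc k n))).mgf_le t
  rw [mgf, hint, hint] at h
  convert h using 3
  push_cast
  rw [add_sub_cancel_left, Real.norm_of_nonneg (by positivity)]

open ProbabilityTheory in
-- By independence the moment generating function factors, and each increment contributes `((k + 1)
-- / 2) ^ 2` to the variance proxy.
theorem hasSubgaussianMGF_edgeCount (n k : ℕ) :
    HasSubgaussianMGF (fun G => edgeCount G - expectedEdges n k)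
      ((n : NNReal) * (((k : NNReal) + 1) / 2) ^ 2) (graphLaw n k) := by
  refine ⟨fun t => Integrable.of_finite, fun t => ?_⟩
  induction n with
  | zero =>
    have : ∀ G : SimpleGraph (Fin 0), edgeCount G = 0 := fun G => by
      simp [edgeCount, Subsingleton.elim G ⊥]
    simp [mgf, this, expectedEdges_zero]
  | succ n ih =>
    rw [mgf, integral_graphLaw_succ n k fun x => Real.exp (t * (x - expectedEdges (n + 1) k))]
    have hsplit : ∀ p : Fin (n + 1), ∫ G, Real.exp (t * (edgeCount G + nearCount k n p -
        expectedEdges (n + 1) k)) ∂graphLaw n k =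
        Real.exp (t * ((nearCount k n p : ℝ) -
          ((n : ℝ) + 1)⁻¹ * ∑ q : Fin (n + 1), (nearCount k n q : ℝ))) *
        mgf (fun G => edgeCount G - expectedEdges n k) (graphLaw n k) t := by
      intro p
      rw [mgf, ← integral_const_mul]
      congr 1 with G
      rw [← Real.exp_add, expectedEdges_succ]
      ring_nf
    rw [Finset.sum_congr rfl fun p _ => hsplit p, ← Finset.sum_mul, ← mul_assoc]
    refine (mul_le_mul (mean_exp_nearCount_le k n t) ih mgf_nonneg (by positivity)).trans_eq ?_
    rw [← Real.exp_add]
    push_cast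
    ring_nf

theorem edgeCount_concentration (n k : ℕ) {t : ℝ} (ht : 0 ≤ t) :
    (graphLaw n k).real {G | |edgeCount G - expectedEdges n k| > ((k : ℝ) + 1) * t} ≤
      2 * Real.exp (-(2 * t ^ 2 / (n : ℝ))) := by
  have h := hasSubgaussianMGF_edgeCount n k
  have hε : 0 ≤ ((k : ℝ) + 1) * t := by positivity
  have hsub : {G : SimpleGraph (Fin n) |
      |edgeCount G - expectedEdges n k| > ((k : ℝ) + 1) * t} ⊆
      {G | ((k : ℝ) + 1) * t ≤ edgeCount G - expectedEdges n k} ∪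
      {G | ((k : ℝ) + 1) * t ≤ (-fun G => edgeCount G - expectedEdges n k) G} := by
    intro G hG
    rw [Set.mem_union, Set.mem_ofPred_eq, Set.mem_ofPred_eq, Pi.neg_apply]
    exact (lt_abs.1 hG).imp le_of_lt le_of_lt
  have hexp : -(((k : ℝ) + 1) * t) ^ 2 /
      (2 * (((n : NNReal) * (((k : NNReal) + 1) / 2) ^ 2 : NNReal) : ℝ)) =
      -(2 * t ^ 2 / (n : ℝ)) := by
    rcases Nat.eq_zero_or_pos n with rfl | hn
    -- For `n = 0` both exponents are divisions by zero, hence `0`, and the bound reads `2`.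
    · simp
    · have : (0 : ℝ) < n := by exact_mod_cast hn
      push_cast
      field_simp
  have h1 := h.measure_ge_le hε
  have h2 := h.neg.measure_ge_le hε
  rw [hexp] at h1 h2
  calc _ ≤ _ := measureReal_mono hsub
    _ ≤ _ := measureReal_union_le _ _
    _ ≤ _ := by linarith

end SemiBar

theorem mainTheorem9 (k : ℕ) :
    (∀ n : ℕ, SemiBar.graphLaw n k = SemiBar.permGraphLaw n k) ∧
    (∀ n : ℕ, n ≤ k + 2 → SemiBar.expectedEdges n k = (n.choose 2 : ℝ)) ∧
    (∀ n : ℕ, k + 3 ≤ n →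
      SemiBar.expectedEdges n k =
        1 / 2 * ((k : ℝ) + 1) *
          (4 * (n : ℝ) - 3 * (k : ℝ) - 6
            - 2 * ((k : ℝ) + 2) * ∑ l ∈ Finset.Icc (k + 3) n, 1 / (l : ℝ))) ∧
    (∃ f : ℕ → ℝ, f =o[Filter.atTop] (fun n : ℕ => (n : ℝ)) ∧
      ∀ n : ℕ, k + 3 ≤ n →
        SemiBar.expectedEdges n k = ((k : ℝ) + 1) * (2 * (n : ℝ) - f n)) ∧
    (∀ (n : ℕ) (t : ℝ), 0 ≤ t →
      (SemiBar.graphLaw n k).real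
          {G | |SemiBar.edgeCount G - SemiBar.expectedEdges n k| > ((k : ℝ) + 1) * t} ≤
        2 * Real.exp (-(2 * t ^ 2 / (n : ℝ)))) :=
  ⟨fun n => (SemiBar.graphLaw_eq_sum_dirac n k).trans (SemiBar.permGraphLaw_eq_sum_dirac n k).symm,
    fun _ h => SemiBar.expectedEdges_of_le h,
    fun _ h => SemiBar.expectedEdges_of_ge (by omega),
    SemiBar.exists_isLittleO_expectedEdges k,
    fun n _ ht => SemiBar.edgeCount_concentration n k ht⟩
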